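/- Let $B$ be a $C^*$-algebra (unital or not) of real rank zero, i.e. the invertible self-adjoint elements of its unitization $B^+=B\oplus\mathbb{C}$ are dense in the self-adjoint elements of $B^+$ (for unital $B$ this is equivalent to the invertible self-adjoint elements of $B$ being dense in the self-adjoint elements of $B$). For a $C^*$-algebra $A$ let $V(A)$ be the abelian monoid of Murray--von Neumann equivalence classes of projections in $M_\infty(A)=\bigcup_n M_n(A)$, with $[p]+[q]=[p\oplus q]$, and for an abelian monoid $M$ let $G(M)$ be its Grothendieck group. Let $K_0(B)$ be the kernel of the homomorphism $G(V(B^+))\to G(V(\mathbb{C}))$ induced by the canonical projection $B^+\to\mathbb{C}$. Then $K_0(B)=G(V(B))$; that is, the homomorphism $V(B)\to V(B^+)$ induced by the inclusion $B\subseteq B^+$ induces an isomorphism of groups $G(V(B))\to K_0(B)$. -/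

import Mathlib

open scoped Matrix

noncomputable section

namespace CStarK

/-! ### Real rank zero -/

/-- A unital C*-algebra has real rank zero if its invertible self-adjoint elements are dense in its
self-adjoint elements. -/
def UnitalRealRankZero (A : Type*) [CStarAlgebra A] : Prop :=
  {a : A | IsSelfAdjoint a} ⊆ closure {b : A | IsSelfAdjoint b ∧ IsUnit b}

/-- A (not necessarily unital) C*-algebra `B` has real rank zero if its unitization
`B⁺ = B ⊕ ℂ` does.  If `B` already has a unit then `B⁺` is isomorphic to the C*-algebra `B × ℂ`,
and this is equivalent to `UnitalRealRankZero B`. -/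
def RealRankZero (B : Type*) [NonUnitalCStarAlgebra B] : Prop :=
  UnitalRealRankZero (Unitization ℂ B)

/-! ### Direct sums of matrices and Murray–von Neumann equivalence -/

section Matrices

/-- The block diagonal sum `a ⊕ b` of two rectangular matrices. -/
def dsum {A : Type*} [Zero A] {m n k l : ℕ} (a : Matrix (Fin m) (Fin k) A)
    (b : Matrix (Fin n) (Fin l) A) : Matrix (Fin (m + n)) (Fin (k + l)) A :=
  (Matrix.fromBlocks a 0 0 b).submatrix finSumFinEquiv.symm finSumFinEquiv.symm

theorem dsum_comm {A : Type*} [Zero A] {m n : ℕ} (p : Matrix (Fin m) (Fin m) A)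
    (q : Matrix (Fin n) (Fin n) A) :
    (dsum q p).submatrix ((finSumFinEquiv.symm.trans (Equiv.sumComm _ _)).trans finSumFinEquiv)
      ((finSumFinEquiv.symm.trans (Equiv.sumComm _ _)).trans finSumFinEquiv) = dsum p q := by
  ext i j
  obtain ⟨i, rfl⟩ := finSumFinEquiv.surjective i
  obtain ⟨j, rfl⟩ := finSumFinEquiv.surjective j
  rcases i with i | i <;> rcases j with j | j <;>
    simp [dsum, -finSumFinEquiv_apply_left, -finSumFinEquiv_apply_right]

theorem dsum_assoc {A : Type*} [Zero A] {m n k : ℕ} (p : Matrix (Fin m) (Fin m) A)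
    (q : Matrix (Fin n) (Fin n) A) (r : Matrix (Fin k) (Fin k) A) :
    (dsum p (dsum q r)).submatrix
      (((finSumFinEquiv.symm.trans (Equiv.sumCongr finSumFinEquiv.symm (Equiv.refl _))).trans
        (Equiv.sumAssoc _ _ _)).trans
        ((Equiv.sumCongr (Equiv.refl _) finSumFinEquiv).trans finSumFinEquiv))
      (((finSumFinEquiv.symm.trans (Equiv.sumCongr finSumFinEquiv.symm (Equiv.refl _))).trans
        (Equiv.sumAssoc _ _ _)).trans
        ((Equiv.sumCongr (Equiv.refl _) finSumFinEquiv).trans finSumFinEquiv)) =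
      dsum (dsum p q) r := by
  have key : ∀ i : Fin (m + n) ⊕ Fin k,
      ∃ l : (Fin m ⊕ Fin n) ⊕ Fin k, i = l.map finSumFinEquiv id := by
    rintro (i | i)
    · exact ⟨.inl (finSumFinEquiv.symm i), by simp⟩
    · exact ⟨.inr i, by simp⟩
  ext i j
  obtain ⟨i, rfl⟩ := finSumFinEquiv.surjective i
  obtain ⟨j, rfl⟩ := finSumFinEquiv.surjective j
  obtain ⟨i, rfl⟩ := key i
  obtain ⟨j, rfl⟩ := key j
  rcases i with (i | i) | i <;> rcases j with (j | j) | j <;>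
    simp [dsum, -finSumFinEquiv_apply_left, -finSumFinEquiv_apply_right]

theorem zero_dsum {A : Type*} [Zero A] {m : ℕ} (p : Matrix (Fin m) (Fin m) A) :
    p.submatrix (finSumFinEquiv.symm.trans (Equiv.emptySum (Fin 0) _))
      (finSumFinEquiv.symm.trans (Equiv.emptySum (Fin 0) _)) =
      dsum (0 : Matrix (Fin 0) (Fin 0) A) p := by
  ext i j
  obtain ⟨i, rfl⟩ := finSumFinEquiv.surjective i
  obtain ⟨j, rfl⟩ := finSumFinEquiv.surjective j
  rcases i with i | i
  · exact i.elim0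
  rcases j with j | j
  · exact j.elim0
  simp [dsum, -finSumFinEquiv_apply_left, -finSumFinEquiv_apply_right]

theorem dsum_mul {A : Type*} [NonUnitalRing A] {m n k l s t : ℕ} (a : Matrix (Fin m) (Fin k) A) (b : Matrix (Fin n) (Fin l) A)
    (c : Matrix (Fin k) (Fin s) A) (d : Matrix (Fin l) (Fin t) A) :
    dsum a b * dsum c d = dsum (a * c) (b * d) := by
  simp [dsum, Matrix.fromBlocks_multiply]

variable {A : Type*} [NonUnitalRing A] [StarRing A]

theorem dsum_conjTranspose {m n k l : ℕ} (a : Matrix (Fin m) (Fin k) A)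
    (b : Matrix (Fin n) (Fin l) A) : (dsum a b)ᴴ = dsum aᴴ bᴴ := by
  simp [dsum, Matrix.fromBlocks_conjTranspose]

theorem isStarProjection_dsum {m n : ℕ} {p : Matrix (Fin m) (Fin m) A}
    {q : Matrix (Fin n) (Fin n) A} (hp : IsStarProjection p) (hq : IsStarProjection q) :
    IsStarProjection (dsum p q) := by
  refine ⟨?_, ?_⟩
  · rw [IsIdempotentElem, dsum_mul, hp.isIdempotentElem.eq, hq.isIdempotentElem.eq]
  · have h1 : pᴴ = p := hp.isSelfAdjoint
    have h2 : qᴴ = q := hq.isSelfAdjoint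
    rw [IsSelfAdjoint, Matrix.star_eq_conjTranspose, dsum_conjTranspose, h1, h2]

variable (A) in
/-- Projections (self-adjoint idempotents) in the matrix algebras `M_n(A)`, over all `n`. -/
structure MatProj where
  /-- the size of the matrix -/
  size : ℕ
  /-- the matrix itself -/
  val : Matrix (Fin size) (Fin size) A
  isProj : IsStarProjection val

/-- Murray–von Neumann equivalence of projections `p ∈ M_m(A)` and `q ∈ M_n(A)`: there is an
`n × m` matrix `v` over `A` with `v* v = p` and `v v* = q`.  The sizes may differ, so that `p` is
identified with `p ⊕ 0`, as in `M_∞(A)`. -/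
def MvN (p q : MatProj A) : Prop :=
  ∃ v : Matrix (Fin q.size) (Fin p.size) A, vᴴ * v = p.val ∧ v * vᴴ = q.val

theorem MvN.refl (p : MatProj A) : MvN p p := by
  have h1 : (p.val)ᴴ = p.val := p.isProj.isSelfAdjoint
  exact ⟨p.val, by rw [h1, p.isProj.isIdempotentElem.eq], by rw [h1, p.isProj.isIdempotentElem.eq]⟩

theorem MvN.symm {p q : MatProj A} (h : MvN p q) : MvN q p := by
  obtain ⟨v, h1, h2⟩ := h
  exact ⟨vᴴ, by simpa using h2, by simpa using h1⟩

theorem MvN.trans {p q r : MatProj A} (h : MvN p q) (h' : MvN q r) : MvN p r := by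
  obtain ⟨v, h1, h2⟩ := h
  obtain ⟨w, h3, h4⟩ := h'
  refine ⟨w * v, ?_, ?_⟩
  · calc (w * v)ᴴ * (w * v) = vᴴ * (wᴴ * w) * v := by
          simp only [Matrix.conjTranspose_mul, Matrix.mul_assoc]
      _ = (vᴴ * v) * (vᴴ * v) := by rw [h3, ← h2]; simp only [Matrix.mul_assoc]
      _ = p.val := by rw [h1, p.isProj.isIdempotentElem.eq]
  · calc (w * v) * (w * v)ᴴ = w * (v * vᴴ) * wᴴ := by
          simp only [Matrix.conjTranspose_mul, Matrix.mul_assoc]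
      _ = (w * wᴴ) * (w * wᴴ) := by rw [h2, ← h3]; simp only [Matrix.mul_assoc]
      _ = r.val := by rw [h4, r.isProj.isIdempotentElem.eq]

variable (A) in
/-- Murray–von Neumann equivalence as a setoid. -/
def mvnSetoid : Setoid (MatProj A) where
  r := MvN
  iseqv := ⟨MvN.refl, MvN.symm, MvN.trans⟩

/-- The direct sum `p ⊕ q` of two projections. -/
def MatProj.add (p q : MatProj A) : MatProj A :=
  ⟨p.size + q.size, dsum p.val q.val, isStarProjection_dsum p.isProj q.isProj⟩

variable (A) in
/-- The zero projection. -/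
def MatProj.zero : MatProj A := ⟨0, 0, .zero _⟩

theorem MvN.add {p p' q q' : MatProj A} (h : MvN p p') (h' : MvN q q') :
    MvN (p.add q) (p'.add q') := by
  obtain ⟨v, h1, h2⟩ := h
  obtain ⟨w, h3, h4⟩ := h'
  refine ⟨dsum v w, ?_, ?_⟩
  · change (dsum v w)ᴴ * dsum v w = dsum p.val q.val
    rw [dsum_conjTranspose, dsum_mul, h1, h3]
  · change dsum v w * (dsum v w)ᴴ = dsum p'.val q'.val
    rw [dsum_conjTranspose, dsum_mul, h2, h4]

theorem MvN.of_reindex {p q : MatProj A} (e : Fin p.size ≃ Fin q.size)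
    (h : q.val.submatrix e e = p.val) : MvN p q := by
  have h1 : (q.val)ᴴ = q.val := q.isProj.isSelfAdjoint
  have h2 : q.val * q.val = q.val := q.isProj.isIdempotentElem.eq
  refine ⟨q.val.submatrix id e, ?_, ?_⟩
  · have := Matrix.submatrix_mul q.val q.val (e : _ → _) (id : _ → _) (e : _ → _)
      Function.bijective_id
    rw [Matrix.conjTranspose_submatrix, h1, ← this, h2, h]
  · rw [Matrix.conjTranspose_submatrix, h1, Matrix.submatrix_mul_equiv, h2, Matrix.submatrix_id_id]

theorem MvN.add_comm (p q : MatProj A) : MvN (p.add q) (q.add p) :=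
  MvN.of_reindex ((finSumFinEquiv.symm.trans (Equiv.sumComm _ _)).trans finSumFinEquiv)
    (dsum_comm p.val q.val)

theorem MvN.add_assoc (p q r : MatProj A) : MvN ((p.add q).add r) (p.add (q.add r)) :=
  MvN.of_reindex (((finSumFinEquiv.symm.trans
    (Equiv.sumCongr finSumFinEquiv.symm (Equiv.refl _))).trans (Equiv.sumAssoc _ _ _)).trans
    ((Equiv.sumCongr (Equiv.refl _) finSumFinEquiv).trans finSumFinEquiv))
    (dsum_assoc p.val q.val r.val)

theorem MvN.zero_add (p : MatProj A) : MvN ((MatProj.zero A).add p) p :=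
  MvN.of_reindex (finSumFinEquiv.symm.trans (Equiv.emptySum (Fin 0) _)) (zero_dsum p.val)

/-! ### The monoid `V(A)` -/

variable (A) in
/-- `V(A)`: Murray–von Neumann equivalence classes of projections in matrices over `A`. -/
def V : Type _ := Quotient (mvnSetoid A)

/-- The class `[p]` in `V(A)` of a projection `p`. -/
def V.mk (p : MatProj A) : V A := Quotient.mk (mvnSetoid A) p

/-- Addition in `V(A)`: `[p] + [q] = [p ⊕ q]`. -/
instance : Add (V A) :=
  ⟨Quotient.map₂ MatProj.add fun _ _ h _ _ h' => MvN.add h h'⟩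

instance : Zero (V A) := ⟨V.mk (MatProj.zero A)⟩

/-- `V(A)` is a commutative monoid. -/
instance : AddCommMonoid (V A) where
  add_assoc := by
    rintro ⟨p⟩ ⟨q⟩ ⟨r⟩
    exact Quotient.sound (s := mvnSetoid A) (MvN.add_assoc p q r)
  zero_add := by
    rintro ⟨p⟩
    exact Quotient.sound (s := mvnSetoid A) (MvN.zero_add p)
  add_zero := by
    rintro ⟨p⟩
    exact Quotient.sound (s := mvnSetoid A) ((MvN.add_comm _ _).trans (MvN.zero_add p))
  add_comm := by
    rintro ⟨p⟩ ⟨q⟩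
    exact Quotient.sound (s := mvnSetoid A) (MvN.add_comm p q)
  nsmul := nsmulRec

end Matrices

/-! ### Functoriality -/

section Functoriality

variable {A A' : Type*} [NonUnitalRing A] [StarRing A] [Module ℂ A]
  [NonUnitalRing A'] [StarRing A'] [Module ℂ A']

/-- A *-homomorphism applied entrywise to a projection. -/
def MatProj.map (f : A →⋆ₙₐ[ℂ] A') (p : MatProj A) : MatProj A' :=
  ⟨p.size, p.val.map f, by
    have h1 : (p.val)ᴴ = p.val := p.isProj.isSelfAdjoint
    refine ⟨?_, ?_⟩
    · rw [IsIdempotentElem, ← Matrix.map_mul, p.isProj.isIdempotentElem.eq]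
    · rw [IsSelfAdjoint, Matrix.star_eq_conjTranspose,
        ← Matrix.conjTranspose_map f (fun a => map_star f a), h1]⟩

theorem MvN.map (f : A →⋆ₙₐ[ℂ] A') {p q : MatProj A} (h : MvN p q) :
    MvN (p.map f) (q.map f) := by
  obtain ⟨v, h1, h2⟩ := h
  refine ⟨v.map f, ?_, ?_⟩
  · change (v.map f)ᴴ * v.map f = p.val.map f
    rw [← Matrix.conjTranspose_map f (fun a => map_star f a), ← Matrix.map_mul, h1]
  · change v.map f * (v.map f)ᴴ = q.val.map f
    rw [← Matrix.conjTranspose_map f (fun a => map_star f a), ← Matrix.map_mul, h2]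

theorem MatProj.map_add (f : A →⋆ₙₐ[ℂ] A') (p q : MatProj A) :
    (p.add q).map f = (p.map f).add (q.map f) := by
  simp [MatProj.map, MatProj.add, dsum, ← Matrix.submatrix_map, Matrix.fromBlocks_map]
  rfl

theorem MatProj.map_zero (f : A →⋆ₙₐ[ℂ] A') :
    (MatProj.zero A).map f = MatProj.zero A' := by
  simp only [MatProj.map, MatProj.zero, MatProj.mk.injEq, heq_eq_eq, true_and]
  ext i
  exact i.elim0

/-- The monoid homomorphism `V(f) : V(A) → V(A')`, `[p] ↦ [f(p)]`. -/
def V.map (f : A →⋆ₙₐ[ℂ] A') : V A →+ V A' where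
  toFun := Quotient.map (MatProj.map f) fun _ _ h => MvN.map f h
  map_zero' := congrArg V.mk (MatProj.map_zero f)
  map_add' := by
    rintro ⟨p⟩ ⟨q⟩
    exact congrArg V.mk (MatProj.map_add f p q)

end Functoriality

/-! ### Grothendieck groups and `K_0` -/

/-- The homomorphism of Grothendieck groups `G(M) → G(N)` induced by a homomorphism `M → N`. -/
def grothendieckMap {M N : Type*} [AddCommMonoid M] [AddCommMonoid N] (f : M →+ N) :
    Algebra.GrothendieckAddGroup M →+ Algebra.GrothendieckAddGroup N :=
  Algebra.GrothendieckAddGroup.lift (Algebra.GrothendieckAddGroup.of.comp f)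

variable (B : Type*) [NonUnitalCStarAlgebra B]

/-- The canonical *-homomorphism `B⁺ = B ⊕ ℂ → ℂ`, `(b, z) ↦ z`. -/
def unitizationProj : Unitization ℂ B →⋆ₙₐ[ℂ] ℂ where
  toFun x := x.fst
  map_smul' := Unitization.fst_smul
  map_zero' := Unitization.fst_zero
  map_add' := Unitization.fst_add
  map_mul' := Unitization.fst_mul
  map_star' := Unitization.fst_star

/-- `K_0(B)` of an arbitrary C*-algebra `B`: the kernel of the homomorphism
`G(V(B⁺)) → G(V(ℂ))` induced by `B⁺ → ℂ`. -/
def K₀ : AddSubgroup (Algebra.GrothendieckAddGroup (V (Unitization ℂ B))) :=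
  (grothendieckMap (V.map (unitizationProj B))).ker

end CStarK

end

/-!
The class of a projection in `V(B⁺)` is compared with that of its scalar part, the tool being
projections `e` in `B` that act as an approximate unit.

*Approximate units.*  For positive `h` in `B` and an invertible self-adjoint `b` in `B⁺` close to
`h - ε`, the positive spectral projection `e` of `b` satisfies `‖(1 - e) h (1 - e)‖ ≤ 2 ε`.  As the
scalar part of `b` is negative, `e` lies in `B` (`exists_isStarProjection_norm_le`).  The diagonal
matrices with constant diagonal `e` then form an approximate unit of projections of `M_n(B)` which
commutes with all scalar matrices (`RealRankZero.isApproxSplit_scalarPart`).  Only this consequence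
of real rank zero is used; it makes real rank zero of `M_n(B)` unnecessary.

*Surjectivity.*  For a projection `p` over `B⁺` with scalar part `s`, and `e` almost a unit for
`p - s`, there is a projection `g` over `B` close to `e p e` such that `p` is close to
`s (1 - e) + g`.  Projections at distance less than one are equivalent, so
`[p] - [s] = [g] - [s e]` comes from `V(B)` (`IsApproxSplit.exists_decomposition`).  A difference
`[p] - [q]` in `K₀(B)` equals `([p] - [s]) - ([q] - [t])`, where `s` and `t` are the scalar parts,
because `[s] - [t]` is the image of `[p] - [q]` under `B⁺ → ℂ → B⁺`.

*Injectivity.*  If `p` and `q` over `B` become equal in `G(V(B⁺))`, there is a partial isometry `v`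
from `p ⊕ 1` to `q ⊕ 1`.  For `e` almost a unit for the part of `v` over `B`, conjugation by `v`
almost fixes `0 ⊕ (1 - e)`, so `p ⊕ e` is carried close to `q ⊕ e`
(`IsApproxSplit.exists_add_equiv`).  These are projections over `B`, and equivalence over `B⁺` of
projections over `B` is equivalence over `B` (`V.map_inr_injective`).
-/

namespace CStarK

/-! ### Projections in unital C*-algebras -/

section Projections

theorem continuousOn_ite_lt {s : Set ℝ} {c : ℝ} (hc : c ∉ s) {f g : ℝ → ℝ}
    (hf : ∀ x ∈ s, c < x → ContinuousAt f x) (hg : ∀ x ∈ s, x < c → ContinuousAt g x) :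
    ContinuousOn (fun x => if c < x then f x else g x) s := by
  intro x hx
  apply ContinuousAt.continuousWithinAt
  rcases lt_trichotomy x c with h | h | h
  · refine (hg x hx h).congr ?_
    filter_upwards [eventually_lt_nhds h] with y hy
    rw [if_neg hy.le.not_gt]
  · exact absurd (h ▸ hx) hc
  · refine (hf x hx h).congr ?_
    filter_upwards [eventually_gt_nhds h] with y hy
    rw [if_pos hy]

variable {M : Type*} [CStarAlgebra M]

/-- Projections at distance less than one are Murray–von Neumann equivalent.  The element
`z = q p + (1 - q)(1 - p)` is invertible and satisfies `z p = q z`, so the unitary part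
`z (z* z)^{-1/2}` of its polar decomposition conjugates `p` into `q`. -/
theorem exists_partialIsometry_of_norm_sub_lt_one {p q : M} (hp : IsStarProjection p)
    (hq : IsStarProjection q) (h : ‖p - q‖ < 1) :
    ∃ v : M, star v * v = p ∧ v * star v = q := by
  have hpp : p * p = p := hp.isIdempotentElem.eq
  have hqq : q * q = q := hq.isIdempotentElem.eq
  have hps : star p = p := hp.isSelfAdjoint.star_eq
  have hqs : star q = q := hq.isSelfAdjoint.star_eq
  obtain ⟨z, hz⟩ : ∃ z, z = q * p + (1 - q) * (1 - p) := ⟨_, rfl⟩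
  have hzp : z * p = q * z := by
    have h1 : (1 - p) * p = 0 := by rw [sub_mul, one_mul, hpp, sub_self]
    have h2 : q * (1 - q) = 0 := by rw [mul_sub, mul_one, hqq, sub_self]
    rw [hz, add_mul, mul_add, mul_assoc q p p, hpp, mul_assoc (1 - q), h1, ← mul_assoc q q, hqq,
      ← mul_assoc q (1 - q), h2, mul_zero, zero_mul]
  have hzu : IsUnit z := by
    have h1 : z = 1 - (2 * q - 1) * (q - p) := by
      rw [hz]; noncomm_ring; simp only [hqq]; abel
    rw [h1]
    apply isUnit_one_sub_of_norm_lt_one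
    rwa [CStarRing.norm_mem_unitary_mul _ hq.two_mul_sub_one_mem_unitary, norm_sub_rev]
  have hzq : p * star z = star z * q := by
    have := congrArg star hzp
    simpa [hps, hqs] using this
  obtain ⟨c, hc⟩ : ∃ c, c = star z * z := ⟨_, rfl⟩
  have hcs : IsSelfAdjoint c := hc ▸ .star_mul_self z
  have hcp : Commute c p := by
    rw [Commute, SemiconjBy, hc, mul_assoc, hzp, ← mul_assoc, ← hzq, mul_assoc]
  have hcu : IsUnit c := hc ▸ hzu.star.mul hzu
  have hpos : ∀ x ∈ spectrum ℝ c, 0 < x := by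
    intro x hx
    refine lt_of_le_of_ne (spectrum_star_mul_self_nonneg x (hc ▸ hx)) ?_
    rintro rfl
    exact spectrum.zero_notMem ℝ hcu hx
  obtain ⟨s, hs⟩ : ∃ s, s = cfc (fun x : ℝ => (√x)⁻¹) c := ⟨_, rfl⟩
  have hcont : ContinuousOn (fun x : ℝ => (√x)⁻¹) (spectrum ℝ c) :=
    Real.continuous_sqrt.continuousOn.inv₀ fun x hx => (Real.sqrt_pos.2 (hpos x hx)).ne'
  have hss : star s = s := by rw [hs]; exact (cfc_predicate _ c : IsSelfAdjoint _).star_eq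
  have hsp : Commute s p := hs ▸ hcp.cfc_real _
  have hsc : Commute s c := hs ▸ (Commute.refl c).cfc_real _
  have hscs : s * c * s = 1 := by
    have h1 : s * c * s = cfc (fun x : ℝ => (√x)⁻¹ * x * (√x)⁻¹) c := by
      rw [cfc_mul (fun x : ℝ => (√x)⁻¹ * x) _ c (hcont.mul continuousOn_id) hcont,
        cfc_mul _ (fun x => x) c hcont continuousOn_id, cfc_id' ℝ c, hs]
    rw [h1, ← cfc_one ℝ c]
    refine cfc_congr fun x hx => ?_
    have := Real.sqrt_pos.2 (hpos x hx)
    have h2 := Real.mul_self_sqrt (hpos x hx).le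
    simp only [Pi.one_apply]
    field_simp
    nlinarith
  have hzsz : z * s * s * star z = 1 := by
    refine hzu.mul_right_cancel ?_
    calc z * s * s * star z * z = z * s * (s * c) := by rw [hc]; simp only [mul_assoc]
      _ = z * (s * c * s) := by rw [mul_assoc z s, mul_assoc s c s, hsc.eq]
      _ = 1 * z := by rw [hscs, mul_one, one_mul]
  refine ⟨z * s * p, ?_, ?_⟩
  · calc star (z * s * p) * (z * s * p) = p * (s * c * s) * p := by
          rw [hc]; simp only [star_mul, hps, hss, mul_assoc]
      _ = p := by rw [hscs, mul_one, hpp]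
  · calc z * s * p * star (z * s * p) = z * (s * (p * p)) * s * star z := by
          simp only [star_mul, hps, hss, mul_assoc]
      _ = (z * p) * s * s * star z := by rw [hpp, hsp.eq]; simp only [mul_assoc]
      _ = q * (z * s * s * star z) := by rw [hzp]; simp only [mul_assoc]
      _ = q := by rw [hzsz, mul_one]

/-- Near an approximately idempotent self-adjoint element `a` there is a projection, namely the
spectral projection of `a` for `(1/2, ∞)`.  Writing it as `a * k` makes it visible that it lies in
every ideal containing `a` and is annihilated by everything that annihilates `a` from the left. -/
theorem exists_isStarProjection_near {a : M} (ha : IsSelfAdjoint a)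
    (h : ‖a * a - a‖ ≤ 1 / 8) :
    ∃ k : M, IsStarProjection (a * k) ∧ ‖a * k - a‖ ≤ 1 / 4 := by
  have hspec : ∀ x ∈ spectrum ℝ a, |x * x - x| ≤ 1 / 8 := by
    have h1 : cfc (fun x : ℝ => x * x - x) a = a * a - a := by
      rw [cfc_sub .., cfc_mul .., cfc_id' ℝ a]
    rw [← h1, norm_cfc_le_iff _ _ (by norm_num)] at h
    exact h
  -- `|x² - x| ≤ 1/8` keeps the spectrum away from the cut at `1/2`.
  have hhalf : (1 / 2 : ℝ) ∉ spectrum ℝ a := by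
    intro hx
    have := hspec _ hx
    norm_num [abs_of_neg] at this
  have hcont : ContinuousOn (fun x : ℝ => if 1 / 2 < x then x⁻¹ else 0) (spectrum ℝ a) := by
    refine continuousOn_ite_lt hhalf (fun x _ hx => continuousAt_inv₀ (by linarith))
      fun _ _ _ => continuousAt_const
  obtain ⟨k, hk⟩ : ∃ k, k = cfc (fun x : ℝ => if 1 / 2 < x then x⁻¹ else 0) a := ⟨_, rfl⟩
  have hak : a * k = cfc (fun x : ℝ => if 1 / 2 < x then 1 else 0) a := by
    nth_rewrite 1 [← cfc_id' ℝ a]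
    rw [hk, ← cfc_mul _ _ a]
    refine cfc_congr fun x hx => ?_
    by_cases h2 : 1 / 2 < x
    · have : x ≠ 0 := by linarith
      simp only [if_pos h2]; field_simp
    · simp only [if_neg h2, mul_zero]
  have hproj : IsStarProjection (a * k) := by
    have hc2 : ContinuousOn (fun x : ℝ => if 1 / 2 < x then (1 : ℝ) else 0) (spectrum ℝ a) :=
      continuousOn_ite_lt hhalf (fun _ _ _ => continuousAt_const) fun _ _ _ => continuousAt_const
    refine ⟨?_, ?_⟩
    · rw [IsIdempotentElem, hak, ← cfc_mul _ _ a]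
      refine cfc_congr fun x hx => ?_
      split_ifs <;> simp
    · rw [hak]; exact cfc_predicate _ a
  refine ⟨k, hproj, ?_⟩
  have hsub : a * k - a = cfc (fun x : ℝ => x * (if 1 / 2 < x then x⁻¹ else 0) - x) a := by
    rw [cfc_sub .., cfc_mul .., cfc_id' ℝ a, hk]
  rw [hsub]
  refine norm_cfc_le (by norm_num) fun x hx => ?_
  have h3 := abs_le.1 (hspec x hx)
  rw [Real.norm_eq_abs, abs_le]
  by_cases h2 : 1 / 2 < x
  · have : x ≠ 0 := by linarith
    rw [if_pos h2, mul_inv_cancel₀ this]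
    constructor <;> nlinarith
  · rw [if_neg h2, mul_zero]
    constructor <;> nlinarith

end Projections

/-! ### Real rank zero and approximate units of projections -/

section RealRankZero

variable {A : Type*} [CStarAlgebra A]

/-- The positive spectral projection of an invertible self-adjoint approximant `b` of `h - ε` almost
acts as a unit on `h`, and it lies in the kernel of `χ` because `χ b` is close to `-ε`, hence
negative. -/
theorem exists_isStarProjection_norm_le (hA : UnitalRealRankZero A) (χ : A →⋆ₐ[ℂ] ℂ)
    [PartialOrder A] [StarOrderedRing A] {h : A} (h0 : 0 ≤ h) (hχ : χ h = 0) {ε : ℝ} (hε : 0 < ε) :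
    ∃ e : A, IsStarProjection e ∧ χ e = 0 ∧ ‖(1 - e) * h * (1 - e)‖ ≤ 2 * ε := by
  have hcont : Continuous χ :=
    AddMonoidHomClass.continuous_of_bound χ 1 fun a => by
      simpa using NonUnitalStarAlgHom.norm_apply_le χ a
  have hsa : IsSelfAdjoint (h - algebraMap ℝ A ε) :=
    (IsSelfAdjoint.of_nonneg h0).sub (.algebraMap A (.all ε))
  obtain ⟨b, ⟨hb, hbu⟩, hdist⟩ := Metric.mem_closure_iff.1 (hA hsa) ε hε
  rw [dist_eq_norm] at hdist
  have hb0 : (0 : ℝ) ∉ spectrum ℝ b := spectrum.zero_notMem ℝ hbu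
  have hcf : ContinuousOn (fun x : ℝ => if 0 < x then (1 : ℝ) else 0) (spectrum ℝ b) :=
    continuousOn_ite_lt hb0 (fun _ _ _ => continuousAt_const) fun _ _ _ => continuousAt_const
  obtain ⟨e, he⟩ : ∃ e, e = cfc (fun x : ℝ => if 0 < x then (1 : ℝ) else 0) b := ⟨_, rfl⟩
  have hep : IsStarProjection e := by
    refine ⟨?_, ?_⟩
    · rw [IsIdempotentElem, he, ← cfc_mul _ _ b]
      refine cfc_congr fun x hx => ?_
      split_ifs <;> simp
    · rw [he]; exact cfc_predicate _ b
  have hχe : χ e = 0 := by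
    have hχb : IsSelfAdjoint (χ b) := hb.map χ
    obtain ⟨r, hr⟩ : ∃ r : ℝ, χ b = algebraMap ℝ ℂ r :=
      ⟨(χ b).re, (Complex.conj_eq_iff_re.1 hχb.star_eq).symm⟩
    have hr0 : r < 0 := by
      have h1 := (NonUnitalStarAlgHom.norm_apply_le χ (h - algebraMap ℝ A ε - b)).trans_lt hdist
      have h2 : χ (h - algebraMap ℝ A ε - b) = ((-ε - r : ℝ) : ℂ) := by
        rw [map_sub, map_sub, hχ, hr, IsScalarTower.algebraMap_apply ℝ ℂ A, AlgHomClass.commutes]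
        simp
      rw [h2, Complex.norm_real, Real.norm_eq_abs, abs_lt] at h1
      linarith
    rw [he, StarAlgHomClass.map_cfc χ _ b hcf hcont hb hχb, hr, cfc_algebraMap, if_neg hr0.le.not_gt,
      map_zero]
  refine ⟨e, hep, hχe, ?_⟩
  have hees : star (1 - e) = 1 - e := hep.one_sub.isSelfAdjoint.star_eq
  have hee : (1 - e) * (1 - e) = 1 - e := hep.one_sub.isIdempotentElem.eq
  have hn : 0 ≤ -((1 - e) * b * (1 - e)) := by
    have h1 : (1 - e) = cfc (fun x : ℝ => 1 - if 0 < x then (1 : ℝ) else 0) b := by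
      rw [cfc_sub .., cfc_const_one ℝ b, he]
    have hc1 : ContinuousOn (fun x : ℝ => 1 - if 0 < x then (1 : ℝ) else 0) (spectrum ℝ b) :=
      continuousOn_const.sub hcf
    have h2 : -((1 - e) * b * (1 - e)) = cfc (fun x : ℝ => -((1 - if 0 < x then (1 : ℝ) else 0) * x
        * (1 - if 0 < x then (1 : ℝ) else 0))) b := by
      rw [cfc_neg, cfc_mul .., cfc_mul .., cfc_id' ℝ b, ← h1]
    rw [h2]
    refine cfc_nonneg fun x hx => ?_
    by_cases h3 : 0 < x
    · simp [h3]
    · simp [h3]; linarith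
  have hpos : 0 ≤ (1 - e) * h * (1 - e) := by
    have := star_left_conjugate_nonneg h0 (1 - e)
    rwa [hees] at this
  -- Compressing `h = ε + b + (h - ε - b)` by `1 - e` leaves only the negative part of `b`.
  have hle : (1 - e) * h * (1 - e) ≤
      ε • (1 - e) + (1 - e) * (h - algebraMap ℝ A ε - b) * (1 - e) := by
    have h1 : ε • (1 - e) + (1 - e) * (h - algebraMap ℝ A ε - b) * (1 - e) =
        (1 - e) * h * (1 - e) + -((1 - e) * b * (1 - e)) := by
      have h2 : (1 - e) * algebraMap ℝ A ε * (1 - e) = ε • (1 - e) := by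
        rw [← Algebra.commutes, mul_assoc, hee, Algebra.smul_def]
      rw [mul_sub (1 - e) (h - _), mul_sub (1 - e) h, sub_mul _ _ (1 - e), sub_mul _ _ (1 - e), h2]
      abel
    rw [h1]
    exact le_add_of_nonneg_right hn
  have hn1 : ‖1 - e‖ ≤ 1 := hep.one_sub.norm_le
  calc ‖(1 - e) * h * (1 - e)‖ ≤ _ := CStarAlgebra.norm_le_norm_of_nonneg_of_le hpos hle
    _ ≤ ‖ε • (1 - e)‖ + ‖(1 - e) * (h - algebraMap ℝ A ε - b) * (1 - e)‖ := norm_add_le _ _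
    _ ≤ ε * 1 + 1 * ε * 1 := by
        gcongr
        · rw [norm_smul, Real.norm_of_nonneg hε.le]; gcongr
        · refine (norm_mul_le _ _).trans ?_
          gcongr
          refine (norm_mul_le _ _).trans ?_
          gcongr
    _ = 2 * ε := by ring

/-- In a unital C*-algebra of real rank zero, the kernel of a character has an approximate unit
consisting of projections. -/
theorem exists_isStarProjection_forall_norm_mul_le (hA : UnitalRealRankZero A)
    (χ : A →⋆ₐ[ℂ] ℂ) {ι : Type*} [Fintype ι] (b : ι → A) (hb : ∀ i, χ (b i) = 0) {δ : ℝ}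
    (hδ : 0 < δ) :
    ∃ e : A, IsStarProjection e ∧ χ e = 0 ∧ ∀ i, ‖b i * (1 - e)‖ ≤ δ := by
  let _ : PartialOrder A := CStarAlgebra.spectralOrder A
  have _ : StarOrderedRing A := CStarAlgebra.spectralOrderedRing A
  obtain ⟨e, he, hχ, hn⟩ := exists_isStarProjection_norm_le hA χ
    (h := ∑ i, star (b i) * b i) (Finset.sum_nonneg fun i _ => star_mul_self_nonneg _)
    (by simp [map_sum, hb]) (ε := δ ^ 2 / 2) (by positivity)
  refine ⟨e, he, hχ, fun i => ?_⟩
  have hees : star (1 - e) = 1 - e := he.one_sub.isSelfAdjoint.star_eq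
  have h1 : star (b i * (1 - e)) * (b i * (1 - e)) ≤
      (1 - e) * (∑ i, star (b i) * b i) * (1 - e) := by
    have h2 := star_left_conjugate_le_conjugate (Finset.single_le_sum (s := Finset.univ)
      (fun i _ => star_mul_self_nonneg (b i)) (Finset.mem_univ i)) (1 - e)
    rw [hees] at h2
    simpa only [star_mul, hees, mul_assoc] using h2
  have h3 := (CStarAlgebra.norm_le_norm_of_nonneg_of_le (star_mul_self_nonneg _) h1).trans hn
  rw [CStarRing.norm_star_mul_self] at h3
  nlinarith [norm_nonneg (b i * (1 - e))]

end RealRankZero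

/-! ### Split extensions with an approximate unit of projections -/

section SplitExtension

variable {M : Type*} [CStarAlgebra M]

/-- An idempotent *-endomorphism `σ` of `M`, regarded as the projection of the split extension
`ker σ ⊕ σ(M)` onto its second summand, such that the ideal `ker σ` has an approximate unit of
projections commuting with `σ(M)`.  Only one element `b` of `ker σ` is approximated at a time. -/
structure IsApproxSplit (σ : M →⋆ₐ[ℂ] M) : Prop where
  map_map : ∀ x, σ (σ x) = σ x
  exists_isStarProjection : ∀ b, σ b = 0 → ∀ δ : ℝ, 0 < δ → ∃ e, IsStarProjection e ∧ σ e = 0 ∧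
    (∀ x, Commute e (σ x)) ∧ ‖b * (1 - e)‖ ≤ δ

variable {σ : M →⋆ₐ[ℂ] M}

theorem isStarProjection_of_star_mul_self {v p : M} (hp : IsStarProjection p)
    (h : star v * v = p) : IsStarProjection (v * star v) := by
  have hpp : p * p = p := hp.isIdempotentElem.eq
  have hvp : v * p = v := by
    rw [← sub_eq_zero, ← CStarRing.star_mul_self_eq_zero_iff, star_sub, star_mul,
      hp.isSelfAdjoint.star_eq, sub_mul, mul_sub, mul_sub, h, mul_assoc p, ← mul_assoc (star v), h,
      mul_assoc p, h, hpp, hpp, sub_self]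
  refine ⟨?_, .mul_star_self v⟩
  rw [IsIdempotentElem, mul_assoc, ← mul_assoc (star v), h, ← mul_assoc, hvp]

/-- Up to Murray–von Neumann equivalence, a projection `p` and its scalar part `σ p` both arise from
one projection `f` by adding an orthogonal projection in `ker σ`.  With `e` an approximate unit for
`p - σ p`, take `f = σ p (1 - e)` and `h = σ p e`, and let `g` be a projection close to `e p e`. -/
theorem IsApproxSplit.exists_decomposition (hσ : IsApproxSplit σ) {p : M}
    (hp : IsStarProjection p) :
    ∃ f g h : M, IsStarProjection f ∧ IsStarProjection g ∧ IsStarProjection h ∧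
      σ g = 0 ∧ σ h = 0 ∧ f * g = 0 ∧ f * h = 0 ∧ f + h = σ p ∧ ‖p - (f + g)‖ < 1 := by
  have hpp : p * p = p := hp.isIdempotentElem.eq
  obtain ⟨s, hs⟩ : ∃ s, s = σ p := ⟨_, rfl⟩
  obtain ⟨b, hb⟩ : ∃ b, b = p - s := ⟨_, rfl⟩
  have hσs : σ s = s := by rw [hs, hσ.map_map]
  have hσb : σ b = 0 := by rw [hb, map_sub, hσs, hs, sub_self]
  have hsp : IsStarProjection s := hs ▸ hp.map σ
  have hbs : star b = b := by
    rw [hb]; exact (hp.isSelfAdjoint.sub hsp.isSelfAdjoint).star_eq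
  obtain ⟨e, he, hσe, hcomm, hbe⟩ := hσ.exists_isStarProjection b hσb (1 / 8) (by norm_num)
  have hee : e * e = e := he.isIdempotentElem.eq
  have hes : star e = e := he.isSelfAdjoint.star_eq
  have hes' : star (1 - e) = 1 - e := he.one_sub.isSelfAdjoint.star_eq
  have hse : Commute e s := hs ▸ hcomm p
  have hbe' : ‖(1 - e) * b‖ ≤ 1 / 8 := by
    rwa [← norm_star, star_mul, hbs, hes']
  have hn : ‖e‖ ≤ 1 := he.norm_le
  have hpn : ‖p‖ ≤ 1 := hp.norm_le
  have ha : IsSelfAdjoint (e * p * e) := by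
    rw [IsSelfAdjoint, star_mul, star_mul, hes, hp.isSelfAdjoint.star_eq, mul_assoc]
  have hps : p = s + b := by rw [hb]; abel
  -- `e` commutes with `s`, so compressing by `e` spoils idempotence of `p` only through `b (1 - e)`.
  have haa : e * p * e * (e * p * e) - e * p * e = -(e * (b * (1 - e)) * p * e) := by
    have h1 : e * s * e = e * s := by rw [hse.eq, mul_assoc, hee]
    have h2 : e * p * (1 - e) = e * (b * (1 - e)) := by
      rw [hps, mul_add, add_mul, mul_sub (e * s), mul_one, h1, sub_self, zero_add, mul_assoc]
    rw [← h2, mul_sub, mul_one, sub_mul, sub_mul, neg_sub]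
    congr 1
    · simp only [mul_assoc]
      rw [← mul_assoc e e, hee]
    · rw [mul_assoc e p p, hpp]
  have hsmall : ‖e * p * e * (e * p * e) - e * p * e‖ ≤ 1 / 8 := by
    rw [haa, norm_neg]
    calc ‖e * (b * (1 - e)) * p * e‖ ≤ ‖e‖ * ‖b * (1 - e)‖ * ‖p‖ * ‖e‖ := by
          refine (norm_mul_le _ _).trans ?_
          gcongr
          refine (norm_mul_le _ _).trans ?_
          gcongr
          exact norm_mul_le _ _
      _ ≤ 1 * (1 / 8) * 1 * 1 := by gcongr
      _ = 1 / 8 := by norm_num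
  obtain ⟨k, hg, hgn⟩ := exists_isStarProjection_near ha hsmall
  refine ⟨s * (1 - e), e * p * e * k, s * e, ?_, hg, ?_, ?_, ?_, ?_, ?_, ?_, ?_⟩
  · exact hsp.mul he.one_sub ((Commute.one_left s).sub_left hse).symm
  · exact hsp.mul he hse.symm
  · simp [hσe]
  · simp [hσe]
  · have : (1 - e) * e = 0 := by rw [sub_mul, one_mul, hee, sub_self]
    simp only [mul_assoc]
    rw [← mul_assoc (1 - e) e, this, zero_mul, mul_zero]
  · have : (1 - e) * e = 0 := by rw [sub_mul, one_mul, hee, sub_self]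
    rw [← hse.eq, mul_assoc, ← mul_assoc (1 - e), this, zero_mul, mul_zero]
  · rw [← hs, mul_sub, mul_one, sub_add_cancel]
  · have h1 : p - (s * (1 - e) + e * p * e * k) =
        b * (1 - e) + (1 - e) * b * e - (e * p * e * k - e * p * e) := by
      have h2 : e * p * e = s * e + e * b * e := by
        rw [hps, mul_add, add_mul, hse.eq, mul_assoc s, hee]
      have h3 : p - s * (1 - e) = s * e + b := by rw [hps, mul_sub, mul_one]; abel
      have h4 : b * (1 - e) + (1 - e) * b * e = b - e * b * e := by noncomm_ring
      rw [h4, ← sub_sub, h3]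
      nth_rewrite 3 [h2]
      abel
    rw [h1]
    calc _ ≤ ‖b * (1 - e)‖ + ‖(1 - e) * b * e‖ + ‖e * p * e * k - e * p * e‖ :=
          (norm_sub_le _ _).trans (by gcongr; exact norm_add_le _ _)
      _ ≤ 1 / 8 + (1 / 8) * 1 + 1 / 4 := by
          gcongr
          exact (norm_mul_le _ _).trans (by gcongr)
      _ < 1 := by norm_num

/-- If `p` and `q` become equivalent after adding a projection `E` fixed by `σ`, then they become
equivalent after adding a subprojection `d` of `E` that lies in `ker σ`.  With `e` an approximate
unit for `v - σ v`, take `d = E e`: conjugation by `v` almost fixes `E (1 - e)`, so it moves `p + d`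
close to `q + d`. -/
theorem IsApproxSplit.exists_add_equiv (hσ : IsApproxSplit σ) {p q E v : M}
    (hp : IsStarProjection p) (hq : IsStarProjection q) (hE : IsStarProjection E)
    (hpE : p * E = 0) (hqE : q * E = 0) (hσp : σ p = 0) (hσq : σ q = 0) (hσE : σ E = E)
    (hv : star v * v = p + E) (hv' : v * star v = q + E) :
    ∃ d : M, IsStarProjection d ∧ σ d = 0 ∧ p * d = 0 ∧ q * d = 0 ∧
      ∃ w, star w * w = p + d ∧ w * star w = q + d := by
  have hpp : p * p = p := hp.isIdempotentElem.eq
  have hEE : E * E = E := hE.isIdempotentElem.eq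
  have hEs : star E = E := hE.isSelfAdjoint.star_eq
  have hps : star p = p := hp.isSelfAdjoint.star_eq
  have hEp : E * p = 0 := by simpa [hps, hEs] using congrArg star hpE
  have hPE : IsStarProjection (p + E) := hp.add hE hpE
  have hQE : IsStarProjection (q + E) := hq.add hE hqE
  obtain ⟨u, hu⟩ : ∃ u, u = σ v := ⟨_, rfl⟩
  have hus : star u * u = E := by
    rw [hu, ← map_star, ← map_mul, hv, map_add, hσp, hσE, zero_add]
  have hus' : u * star u = E := by
    rw [hu, ← map_star, ← map_mul, hv', map_add, hσq, hσE, zero_add]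
  obtain ⟨b, hb⟩ : ∃ b, b = v - u := ⟨_, rfl⟩
  have hσb : σ b = 0 := by rw [hb, hu, map_sub, hσ.map_map, sub_self]
  obtain ⟨e, he, hσe, hcomm, hbe⟩ := hσ.exists_isStarProjection b hσb (1 / 4) (by norm_num)
  have heu : Commute e u := hu ▸ hcomm v
  have heE : Commute e E := hσE ▸ hcomm E
  have heu' : Commute (1 - e) u := (Commute.one_left u).sub_left heu
  have heE' : Commute (1 - e) E := (Commute.one_left E).sub_left heE
  obtain ⟨F, hF⟩ : ∃ F, F = E * (1 - e) := ⟨_, rfl⟩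
  have hFproj : IsStarProjection F := hF ▸ hE.mul he.one_sub heE'.symm
  have hFs : star F = F := hFproj.isSelfAdjoint.star_eq
  have hd : IsStarProjection (E * e) := hE.mul he heE.symm
  have hdF : E * e = E - F := by rw [hF, mul_sub, mul_one, sub_sub_cancel]
  have hpd : p * (E * e) = 0 := by rw [← mul_assoc, hpE, zero_mul]
  have hqd : q * (E * e) = 0 := by rw [← mul_assoc, hqE, zero_mul]
  have hPd : IsStarProjection (p + E * e) := hp.add hd hpd
  have hn : ∀ {x y : M}, IsStarProjection y → star x * x = y → ‖x‖ ≤ 1 := by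
    intro x y hy hxy
    have h1 : ‖star x * x‖ ≤ 1 := hxy ▸ hy.norm_le
    rw [CStarRing.norm_star_mul_self] at h1
    nlinarith [norm_nonneg x]
  have hvn : ‖v‖ ≤ 1 := hn hPE hv
  have hun : ‖u‖ ≤ 1 := hn hE hus
  -- The scalar part `u` of `v` commutes with `e`, so it fixes `F` exactly.
  have huF : u * F * star u = F := by
    rw [hF, ← heE'.eq, ← mul_assoc, ← heu'.eq, mul_assoc, mul_assoc]
    congr 1
    rw [← hus]
    calc u * (star u * u * star u) = (u * star u) * (u * star u) := by simp only [mul_assoc]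
      _ = star u * u := by rw [hus', hEE, hus]
  have hbF : ‖b * F‖ ≤ 1 / 4 := by
    rw [hF, ← heE'.eq, ← mul_assoc]
    calc _ ≤ ‖b * (1 - e)‖ * ‖E‖ := norm_mul_le _ _
      _ ≤ 1 / 4 * 1 := by gcongr; exact hE.norm_le
      _ = 1 / 4 := mul_one _
  have hvF : ‖v * F * star v - F‖ < 1 := by
    have h1 : v * F * star v - F = b * F * star v + u * star (b * F) := by
      rw [star_mul, hFs]
      nth_rewrite 2 [← huF]
      rw [hb, star_sub]
      noncomm_ring
    rw [h1]
    calc _ ≤ ‖b * F‖ * ‖v‖ + ‖u‖ * ‖b * F‖ := by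
          refine (norm_add_le _ _).trans ?_
          gcongr
          · exact (norm_mul_le _ _).trans_eq (by rw [norm_star])
          · exact (norm_mul_le _ _).trans_eq (by rw [norm_star])
      _ ≤ 1 / 4 * 1 + 1 * (1 / 4) := by gcongr
      _ < 1 := by norm_num
  obtain ⟨w, hw⟩ : ∃ w, w = v * (p + E * e) := ⟨_, rfl⟩
  -- `p + E e` is a subprojection of `p + E = v* v`.
  have hws : star w * w = p + E * e := by
    have h1 : (p + E) * (p + E * e) = p + E * e := by
      rw [add_mul, mul_add, mul_add, hpp, hpd, hEp, ← mul_assoc, hEE, add_zero, zero_add]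
    calc star w * w = (p + E * e) * ((star v * v) * (p + E * e)) := by
          rw [hw, star_mul, hPd.isSelfAdjoint.star_eq]; simp only [mul_assoc]
      _ = p + E * e := by rw [hv, h1, hPd.isIdempotentElem.eq]
  have hws' : w * star w = v * (p + E * e) * star v := by
    rw [hw, star_mul, hPd.isSelfAdjoint.star_eq, ← mul_assoc, mul_assoc v, hPd.isIdempotentElem.eq]
  have hclose : ‖w * star w - (q + E * e)‖ < 1 := by
    have h1 : v * (p + E) * star v = q + E := by
      rw [← hv, ← mul_assoc, mul_assoc, hv', hQE.isIdempotentElem.eq]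
    have h2 : w * star w - (q + E * e) = -(v * F * star v - F) := by
      rw [hws', hdF, ← add_sub_assoc, mul_sub, sub_mul, h1]
      abel
    rwa [h2, norm_neg]
  obtain ⟨z, hz, hz'⟩ := exists_partialIsometry_of_norm_sub_lt_one
    (isStarProjection_of_star_mul_self hPd hws) (hq.add hd hqd) hclose
  refine ⟨E * e, hd, by rw [map_mul, hσe, mul_zero], hpd, hqd, z * w, ?_, ?_⟩
  · calc star (z * w) * (z * w) = star w * (star z * z) * w := by
          simp only [star_mul, mul_assoc]
      _ = (star w * w) * (star w * w) := by rw [hz]; simp only [mul_assoc]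
      _ = p + E * e := by rw [hws, hPd.isIdempotentElem.eq]
  · calc z * w * star (z * w) = z * (w * star w) * star z := by
          simp only [star_mul, mul_assoc]
      _ = (z * star z) * (z * star z) := by rw [← hz]; simp only [mul_assoc]
      _ = q + E * e := by rw [hz', (hq.add hd hqd).isIdempotentElem.eq]

end SplitExtension

/-! ### Computing in `V(A)` -/

section Monoid

theorem V.mk_eq_mk_iff {A : Type*} [NonUnitalRing A] [StarRing A] {p q : MatProj A} :
    V.mk p = V.mk q ↔ MvN p q :=
  ⟨fun h => Quotient.exact h, fun h => Quotient.sound h⟩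

theorem V.mk_surjective {A : Type*} [NonUnitalRing A] [StarRing A] :
    Function.Surjective (V.mk (A := A)) :=
  Quotient.mk_surjective

theorem V.mk_add {A : Type*} [NonUnitalRing A] [StarRing A] (p q : MatProj A) :
    V.mk (p.add q) = V.mk p + V.mk q := rfl

variable {A : Type*} [Ring A] [StarRing A]

theorem V.mk_eq_of_conjTranspose_mul_self {m n : ℕ} {p : Matrix (Fin m) (Fin m) A}
    {q : Matrix (Fin n) (Fin n) A} (hp : IsStarProjection p) (hq : IsStarProjection q)
    (v : Matrix (Fin n) (Fin m) A) (h : vᴴ * v = p) (h' : v * vᴴ = q) :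
    V.mk ⟨m, p, hp⟩ = V.mk ⟨n, q, hq⟩ :=
  V.mk_eq_mk_iff.2 ⟨v, h, h'⟩

theorem V.mk_zero_matrix {A : Type*} [NonUnitalRing A] [StarRing A] (n : ℕ) :
    V.mk (⟨n, 0, .zero _⟩ : MatProj A) = 0 :=
  V.mk_eq_mk_iff.2 ⟨(0 : Matrix (Fin 0) (Fin n) A), Matrix.mul_zero _, Matrix.zero_mul _⟩

theorem V.mk_add_of_mul_eq_zero {n : ℕ} {p q : Matrix (Fin n) (Fin n) A}
    (hp : IsStarProjection p) (hq : IsStarProjection q) (hpq : p * q = 0) :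
    V.mk ⟨n, p + q, hp.add hq hpq⟩ = V.mk ⟨n, p, hp⟩ + V.mk ⟨n, q, hq⟩ := by
  have hpp : p * p = p := hp.isIdempotentElem.eq
  have hqq : q * q = q := hq.isIdempotentElem.eq
  have hps : pᴴ = p := hp.isSelfAdjoint
  have hqs : qᴴ = q := hq.isSelfAdjoint
  have hqp : q * p = 0 := by simpa [hps, hqs] using congrArg Matrix.conjTranspose hpq
  -- The row `(p q)` is a partial isometry from `p ⊕ q` to `p + q`.
  refine (V.mk_eq_of_conjTranspose_mul_self (isStarProjection_dsum hp hq) (hp.add hq hpq)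
    ((Matrix.fromCols p q).submatrix id finSumFinEquiv.symm) ?_ ?_).symm
  · rw [Matrix.conjTranspose_submatrix, Matrix.conjTranspose_fromCols_eq_fromRows_conjTranspose,
      ← Matrix.submatrix_mul _ _ _ id _ Function.bijective_id, Matrix.fromRows_mul_fromCols,
      hps, hqs, hpp, hqq, hpq, hqp]
    rfl
  · rw [Matrix.conjTranspose_submatrix, Matrix.conjTranspose_fromCols_eq_fromRows_conjTranspose,
      Matrix.submatrix_mul_equiv, Matrix.fromCols_mul_fromRows, hps, hqs, hpp, hqq,
      Matrix.submatrix_id_id]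

end Monoid

theorem V.mk_eq_of_norm_sub_lt_one {A : Type*} [CStarAlgebra A] [PartialOrder A]
    [StarOrderedRing A] {n : ℕ} {p q : CStarMatrix (Fin n) (Fin n) A} (hp : IsStarProjection p)
    (hq : IsStarProjection q) (h : ‖p - q‖ < 1) : V.mk ⟨n, p, hp⟩ = V.mk ⟨n, q, hq⟩ :=
  V.mk_eq_mk_iff.2 (exists_partialIsometry_of_norm_sub_lt_one hp hq h)

/-! ### Matrices over the unitization -/

section Unitization

variable (B : Type*) [NonUnitalCStarAlgebra B]

/-- The unital *-homomorphism `ℂ → B⁺`, `z ↦ (0, z)`, splitting `unitizationProj B`. -/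
noncomputable def unitizationSection : ℂ →⋆ₙₐ[ℂ] Unitization ℂ B where
  toFun z := algebraMap ℂ _ z
  map_smul' r z := by simp [Algebra.smul_def]
  map_zero' := map_zero _
  map_add' := map_add _
  map_mul' := map_mul _
  map_star' := algebraMap_star_comm

/-- `unitizationProj B` as a unital *-homomorphism. -/
noncomputable def unitizationCharacter : Unitization ℂ B →⋆ₐ[ℂ] ℂ where
  toAlgHom := Unitization.fstHom ℂ B
  map_star' := Unitization.fst_star

/-- The composite `B⁺ → ℂ → B⁺`, `(b, z) ↦ (0, z)`. -/
noncomputable def entryScalarPart : Unitization ℂ B →⋆ₐ[ℂ] Unitization ℂ B :=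
  (StarAlgHom.ofId ℂ (Unitization ℂ B)).comp (unitizationCharacter B)

/-- The *-endomorphism of `M_n(B⁺)` replacing each entry `(b, z)` by its scalar part `(0, z)`; its
kernel is `M_n(B)`. -/
noncomputable def scalarPart (n : ℕ) : CStarMatrix (Fin n) (Fin n) (Unitization ℂ B) →⋆ₐ[ℂ]
    CStarMatrix (Fin n) (Fin n) (Unitization ℂ B) where
  toFun x := CStarMatrix.ofMatrix (Matrix.map x (entryScalarPart B))
  map_one' := Matrix.map_one (entryScalarPart B) (map_zero _) (map_one _)
  map_zero' := Matrix.map_zero (entryScalarPart B) (map_zero _)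
  map_add' x y := Matrix.map_add (entryScalarPart B) (map_add _) x y
  map_mul' x y := Matrix.map_mul (L := CStarMatrix.ofMatrix.symm x)
    (M := CStarMatrix.ofMatrix.symm y) (f := entryScalarPart B)
  map_star' x := Matrix.conjTranspose_map (A := CStarMatrix.ofMatrix.symm x) (entryScalarPart B)
    (map_star (entryScalarPart B))
  commutes' r := Matrix.map_algebraMap r (entryScalarPart B) (map_zero _)
    (AlgHomClass.commutes (entryScalarPart B) r)

variable {B}

theorem scalarPart_apply {n : ℕ} (x : CStarMatrix (Fin n) (Fin n) (Unitization ℂ B)) (i j : Fin n) :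
    scalarPart B n x i j = algebraMap ℂ _ (x i j).fst := rfl

theorem fst_scalarPart {n : ℕ} (x : CStarMatrix (Fin n) (Fin n) (Unitization ℂ B)) (i j : Fin n) :
    (scalarPart B n x i j).fst = (x i j).fst := by
  rw [scalarPart_apply, Unitization.algebraMap_eq_inl, Unitization.fst_inl]

theorem scalarPart_eq_zero_iff {n : ℕ} {x : CStarMatrix (Fin n) (Fin n) (Unitization ℂ B)} :
    scalarPart B n x = 0 ↔ ∀ i j, (x i j).fst = 0 := by
  refine ⟨fun h i j => ?_, fun h => CStarMatrix.ext fun i j => ?_⟩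
  · rw [← fst_scalarPart, h]; rfl
  · rw [scalarPart_apply, h, map_zero]; rfl

theorem RealRankZero.isApproxSplit_scalarPart [PartialOrder (Unitization ℂ B)]
    [StarOrderedRing (Unitization ℂ B)] (hB : RealRankZero B) (n : ℕ) :
    IsApproxSplit (scalarPart B n) where
  map_map x := CStarMatrix.ext fun i j => by
    rw [scalarPart_apply, fst_scalarPart, scalarPart_apply]
  exists_isStarProjection b hb δ hδ := by
    rw [scalarPart_eq_zero_iff] at hb
    have hsmall : ∀ m : ℕ, ∃ e : Unitization ℂ B, IsStarProjection e ∧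
        unitizationCharacter B e = 0 ∧
          ∀ i : Fin n × Fin n, ‖b i.1 i.2 * (1 - e)‖ ≤ 1 / ((m : ℝ) + 1) := fun m =>
      exists_isStarProjection_forall_norm_mul_le hB (unitizationCharacter B)
        (fun i : Fin n × Fin n => b i.1 i.2) (fun i => hb i.1 i.2) (by positivity)
    choose e he hχ hn using hsmall
    -- The topology of `CStarMatrix` is the product topology, so entrywise convergence suffices.
    have hlim : Filter.Tendsto (fun m => (CStarMatrix.ofMatrix fun i j => b i j * (1 - e m) :
        CStarMatrix (Fin n) (Fin n) (Unitization ℂ B))) Filter.atTop (nhds 0) := by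
      refine tendsto_pi_nhds.2 fun i => tendsto_pi_nhds.2 fun j => ?_
      exact squeeze_zero_norm (fun m => hn m (i, j)) tendsto_one_div_add_atTop_nhds_zero_nat
    obtain ⟨m, hm⟩ := (Metric.tendsto_nhds.1 hlim δ hδ).exists
    rw [dist_zero_right] at hm
    have hmul : b * (1 - CStarMatrix.ofMatrix (Matrix.diagonal fun _ => e m)) =
        CStarMatrix.ofMatrix fun i j => b i j * (1 - e m) := by
      rw [mul_sub, mul_one]
      refine CStarMatrix.ext fun i j => ?_
      refine Eq.trans ?_ (mul_one_sub (b i j) (e m)).symm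
      exact congrArg (b i j - ·) (Matrix.mul_diagonal (fun _ => e m) (CStarMatrix.ofMatrix.symm b) i j)
    refine ⟨CStarMatrix.ofMatrix (Matrix.diagonal fun _ => e m), ⟨?_, ?_⟩, ?_, fun x => ?_,
      hmul ▸ hm.le⟩
    · refine (Matrix.diagonal_mul_diagonal _ _).trans ?_
      rw [(he m).isIdempotentElem.eq]; rfl
    · refine (Matrix.diagonal_conjTranspose _).trans ?_
      rw [show star (fun _ : Fin n => e m) = fun _ => e m from
        funext fun _ => (he m).isSelfAdjoint.star_eq]
      rfl
    · refine scalarPart_eq_zero_iff.2 fun i j => ?_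
      rcases eq_or_ne i j with rfl | hij
      · exact (congrArg _ (Matrix.diagonal_apply_eq (fun _ => e m) i)).trans (hχ m)
      · exact congrArg (fun a : Unitization ℂ B => a.fst) (Matrix.diagonal_apply_ne (fun _ => e m) hij)
    · refine CStarMatrix.ext fun i j => ?_
      refine (Matrix.diagonal_mul (fun _ => e m)
        (CStarMatrix.ofMatrix.symm (scalarPart B n x)) i j).trans ?_
      refine Eq.trans ?_ (Matrix.mul_diagonal (fun _ => e m)
        (CStarMatrix.ofMatrix.symm (scalarPart B n x)) i j).symm
      exact (Algebra.commutes (x i j).fst (e m)).symm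

theorem unitizationProj_comp_inr (x : V B) :
    V.map (unitizationProj B) (V.map (Unitization.inrNonUnitalStarAlgHom ℂ B) x) = 0 := by
  obtain ⟨p, rfl⟩ := V.mk_surjective x
  rw [← V.mk_zero_matrix p.size]
  refine congrArg V.mk ?_
  have : (p.val.map (Unitization.inrNonUnitalStarAlgHom ℂ B)).map (unitizationProj B) = 0 := rfl
  simp only [MatProj.map, this]

open scoped ComplexOrder in
/-- `V(B) → V(B⁺)` is injective: a partial isometry over `B⁺` between projections over `B` has its
entries in `B`, because its scalar part `w` satisfies `w* w = 0`. -/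
theorem V.map_inr_injective :
    Function.Injective (V.map (Unitization.inrNonUnitalStarAlgHom ℂ B)) := by
  intro x y h
  obtain ⟨p, rfl⟩ := V.mk_surjective x
  obtain ⟨q, rfl⟩ := V.mk_surjective y
  obtain ⟨v, h1, h2⟩ := V.mk_eq_mk_iff.1 h
  have hv : v.map (unitizationProj B) = 0 := by
    rw [← Matrix.conjTranspose_mul_self_eq_zero, ← Matrix.conjTranspose_map _ (map_star _),
      ← Matrix.map_mul, h1]
    rfl
  obtain ⟨w, rfl⟩ : ∃ w : Matrix (Fin q.size) (Fin p.size) B,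
      w.map (Unitization.inrNonUnitalStarAlgHom ℂ B) = v := by
    refine ⟨v.map (fun x => x.snd), Matrix.ext fun i j => Unitization.ext ?_ ?_⟩
    · exact (congrFun₂ hv i j).symm
    · rfl
  have hinj : Function.Injective (Unitization.inrNonUnitalStarAlgHom ℂ B) :=
    Unitization.inr_injective
  refine V.mk_eq_mk_iff.2 ⟨w, Matrix.map_injective hinj ?_, Matrix.map_injective hinj ?_⟩
  · beta_reduce
    rw [Matrix.map_mul, Matrix.conjTranspose_map _ (map_star _)]; exact h1
  · beta_reduce
    rw [Matrix.map_mul, Matrix.conjTranspose_map _ (map_star _)]; exact h2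

/-- A projection over `B⁺` with vanishing scalar part has its class in the image of `V(B)`. -/
theorem V.exists_map_inr_eq {n : ℕ} {p : CStarMatrix (Fin n) (Fin n) (Unitization ℂ B)}
    (hp : IsStarProjection p) (h : scalarPart B n p = 0) :
    ∃ x : V B, V.map (Unitization.inrNonUnitalStarAlgHom ℂ B) x = V.mk ⟨n, p, hp⟩ := by
  rw [scalarPart_eq_zero_iff] at h
  obtain ⟨w, rfl⟩ : ∃ w : Matrix (Fin n) (Fin n) B,
      w.map (Unitization.inrNonUnitalStarAlgHom ℂ B) = p :=
    ⟨Matrix.map p (fun x => x.snd), Matrix.ext fun i j => Unitization.ext (h i j).symm rfl⟩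
  have hinj : Function.Injective (Unitization.inrNonUnitalStarAlgHom ℂ B) :=
    Unitization.inr_injective
  refine ⟨V.mk ⟨n, w, Matrix.map_injective hinj ?_, Matrix.map_injective hinj ?_⟩, rfl⟩
  · change (w * w).map _ = _
    rw [Matrix.map_mul]; exact hp.isIdempotentElem.eq
  · change wᴴ.map _ = _
    rw [Matrix.conjTranspose_map _ (map_star _)]; exact hp.isSelfAdjoint.star_eq

end Unitization

/-! ### Grothendieck groups -/

section Grothendieck

open Algebra

theorem grothendieckMap_of {M N : Type*} [AddCommMonoid M] [AddCommMonoid N] (f : M →+ N) (x : M) :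
    grothendieckMap f (GrothendieckAddGroup.of x) = GrothendieckAddGroup.of (f x) :=
  DFunLike.congr_fun (GrothendieckAddGroup.lift.symm_apply_apply
    ((GrothendieckAddGroup.of (M := N)).comp f)) x

theorem exists_eq_of_sub_of {M : Type*} [AddCommMonoid M] (g : GrothendieckAddGroup M) :
    ∃ x y : M, g = GrothendieckAddGroup.of x - GrothendieckAddGroup.of y := by
  obtain ⟨⟨x, y⟩, h⟩ := (AddLocalization.addMonoidOf (⊤ : AddSubmonoid M)).surj g
  exact ⟨x, y, eq_sub_of_add_eq h⟩

theorem of_eq_of_iff {M : Type*} [AddCommMonoid M] {x y : M} :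
    GrothendieckAddGroup.of x = GrothendieckAddGroup.of y ↔ ∃ c, x + c = y + c := by
  refine ((AddLocalization.addMonoidOf (⊤ : AddSubmonoid M)).eq_iff_exists).trans ?_
  simp [add_comm]

end Grothendieck

/-! ### Comparison of `V(B)` and `V(B⁺)` -/

section Comparison

variable {B : Type*} [NonUnitalCStarAlgebra B]

/-- In `G(V(B⁺))` every class differs from that of its scalar part by an element coming from
`G(V(B))`. -/
theorem V.exists_add_map_section_eq (hB : RealRankZero B) (X : V (Unitization ℂ B)) :
    ∃ x y : V B, X + V.map (Unitization.inrNonUnitalStarAlgHom ℂ B) y =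
      V.map (unitizationSection B) (V.map (unitizationProj B) X) +
        V.map (Unitization.inrNonUnitalStarAlgHom ℂ B) x := by
  let _ : PartialOrder (Unitization ℂ B) := CStarAlgebra.spectralOrder _
  have _ : StarOrderedRing (Unitization ℂ B) := CStarAlgebra.spectralOrderedRing _
  obtain ⟨⟨n, p, hp⟩, rfl⟩ := V.mk_surjective X
  obtain ⟨f, g, h, hf, hg, hh, hσg, hσh, hfg, hfh, hs, hclose⟩ :=
    (hB.isApproxSplit_scalarPart n).exists_decomposition (p := CStarMatrix.ofMatrix p) hp
  obtain ⟨x, hx⟩ := V.exists_map_inr_eq hg hσg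
  obtain ⟨y, hy⟩ := V.exists_map_inr_eq hh hσh
  have h1 : V.mk ⟨n, p, hp⟩ = V.mk ⟨n, f, hf⟩ + V.mk ⟨n, g, hg⟩ :=
    (V.mk_eq_of_norm_sub_lt_one hp (hf.add hg hfg) hclose).trans
      (V.mk_add_of_mul_eq_zero hf hg hfg)
  have h2 : V.map (unitizationSection B) (V.map (unitizationProj B) (V.mk ⟨n, p, hp⟩)) =
      V.mk ⟨n, f, hf⟩ + V.mk ⟨n, h, hh⟩ := by
    rw [← V.mk_add_of_mul_eq_zero hf hh hfh]
    refine congrArg V.mk ?_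
    simp only [MatProj.map]
    congr 1
    exact hs.symm
  refine ⟨x, y, ?_⟩
  rw [h2, h1, hx, hy, add_right_comm]

theorem dsum_map {A A' : Type*} [Zero A] [Zero A'] {m n k l : ℕ} (a : Matrix (Fin m) (Fin k) A)
    (b : Matrix (Fin n) (Fin l) A) {f : A → A'} (hf : f 0 = 0) :
    (dsum a b).map f = dsum (a.map f) (b.map f) := by
  rw [dsum, ← Matrix.submatrix_map, Matrix.fromBlocks_map, Matrix.map_zero _ hf,
    Matrix.map_zero _ hf, dsum]

theorem dsum_zero_zero {A : Type*} [Zero A] {m n k l : ℕ} :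
    dsum (0 : Matrix (Fin m) (Fin k) A) (0 : Matrix (Fin n) (Fin l) A) = 0 := by
  rw [dsum, Matrix.fromBlocks_zero]; rfl

theorem V.exists_add_eq_one (X : V (Unitization ℂ B)) :
    ∃ (Y : V (Unitization ℂ B)) (n : ℕ), X + Y = V.mk ⟨n, 1, .one _⟩ := by
  obtain ⟨⟨n, p, hp⟩, rfl⟩ := V.mk_surjective X
  have h : p * (1 - p) = 0 := by rw [mul_sub, mul_one, hp.isIdempotentElem.eq, sub_self]
  refine ⟨V.mk ⟨n, 1 - p, hp.one_sub⟩, n, ?_⟩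
  refine (V.mk_add_of_mul_eq_zero hp hp.one_sub h).symm.trans ?_
  simp only [add_sub_cancel]

/-- Classes in `V(B)` that become stably equal in `V(B⁺)` are stably equal in `V(B)`. -/
theorem V.exists_add_eq_add (hB : RealRankZero B) {x y : V B} {c : V (Unitization ℂ B)}
    (h : V.map (Unitization.inrNonUnitalStarAlgHom ℂ B) x + c =
      V.map (Unitization.inrNonUnitalStarAlgHom ℂ B) y + c) :
    ∃ z : V B, x + z = y + z := by
  let _ : PartialOrder (Unitization ℂ B) := CStarAlgebra.spectralOrder _
  have _ : StarOrderedRing (Unitization ℂ B) := CStarAlgebra.spectralOrderedRing _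
  obtain ⟨c', n, hc⟩ := V.exists_add_eq_one c
  replace h := congrArg (· + c') h
  simp only [add_assoc, hc] at h
  obtain ⟨p, rfl⟩ := V.mk_surjective x
  obtain ⟨q, rfl⟩ := V.mk_surjective y
  -- Block diagonal sums with zero matrices make room for `p`, `q` and the unit matrix in matrices
  -- of one common size.
  let N : ℕ := p.size + q.size + n
  let p₁ : MatProj B := (p.add ⟨q.size, 0, .zero _⟩).add ⟨n, 0, .zero _⟩
  let q₁ : MatProj B := (MatProj.add ⟨p.size, 0, .zero _⟩ q).add ⟨n, 0, .zero _⟩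
  have hp₁ : V.mk p₁ = V.mk p := by
    rw [V.mk_add, V.mk_add, V.mk_zero_matrix, V.mk_zero_matrix, add_zero, add_zero]
  have hq₁ : V.mk q₁ = V.mk q := by
    rw [V.mk_add, V.mk_add, V.mk_zero_matrix, V.mk_zero_matrix, add_zero, zero_add]
  let E : Matrix (Fin N) (Fin N) (Unitization ℂ B) :=
    dsum (0 : Matrix (Fin (p.size + q.size)) (Fin (p.size + q.size)) (Unitization ℂ B))
      (1 : Matrix (Fin n) (Fin n) (Unitization ℂ B))
  have hE : IsStarProjection E := isStarProjection_dsum (.zero _) (.one _)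
  have hEmk : V.mk ⟨N, E, hE⟩ = V.mk ⟨n, 1, .one _⟩ := by
    refine (V.mk_add ⟨p.size + q.size, 0, .zero _⟩ ⟨n, 1, .one _⟩).trans ?_
    rw [V.mk_zero_matrix, zero_add]
  have hσE : scalarPart B N (CStarMatrix.ofMatrix E) = CStarMatrix.ofMatrix E := by
    refine (dsum_map _ _ (map_zero (entryScalarPart B))).trans ?_
    rw [Matrix.map_zero _ (map_zero _), Matrix.map_one _ (map_zero _) (map_one _)]
    rfl
  let ι := Unitization.inrNonUnitalStarAlgHom ℂ B
  have horth : ∀ a : Matrix (Fin (p.size + q.size)) (Fin (p.size + q.size)) B,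
      (dsum a (0 : Matrix (Fin n) (Fin n) B)).map ι * E = 0 := by
    intro a
    rw [dsum_map _ _ (map_zero ι), dsum_mul, Matrix.mul_zero, Matrix.map_zero _ (map_zero ι),
      Matrix.zero_mul, dsum_zero_zero]
  let P : Matrix (Fin N) (Fin N) (Unitization ℂ B) := (p₁.map ι).val
  let Q : Matrix (Fin N) (Fin N) (Unitization ℂ B) := (q₁.map ι).val
  have hP : IsStarProjection P := (p₁.map ι).isProj
  have hQ : IsStarProjection Q := (q₁.map ι).isProj
  have hPE : P * E = 0 := horth _
  have hQE : Q * E = 0 := horth _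
  have hPmk : V.mk ⟨N, P, hP⟩ = V.map ι (V.mk p) := congrArg (V.map ι) hp₁
  have hQmk : V.mk ⟨N, Q, hQ⟩ = V.map ι (V.mk q) := congrArg (V.map ι) hq₁
  have hequiv : V.mk ⟨N, P + E, hP.add hE hPE⟩ = V.mk ⟨N, Q + E, hQ.add hE hQE⟩ := by
    rw [V.mk_add_of_mul_eq_zero hP hE hPE, V.mk_add_of_mul_eq_zero hQ hE hQE, hEmk, hPmk, hQmk]
    exact h
  obtain ⟨v, hv, hv'⟩ := V.mk_eq_mk_iff.1 hequiv
  obtain ⟨d, hd, hσd, hPd, hQd, w, hw, hw'⟩ :=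
    (hB.isApproxSplit_scalarPart N).exists_add_equiv (p := CStarMatrix.ofMatrix P)
      (q := CStarMatrix.ofMatrix Q) (E := CStarMatrix.ofMatrix E) (v := CStarMatrix.ofMatrix v)
      hP hQ hE hPE hQE (scalarPart_eq_zero_iff.2 fun _ _ => rfl)
      (scalarPart_eq_zero_iff.2 fun _ _ => rfl) hσE hv hv'
  obtain ⟨z, hz⟩ := V.exists_map_inr_eq hd hσd
  have key : V.mk ⟨N, P, hP⟩ + V.mk ⟨N, d, hd⟩ = V.mk ⟨N, Q, hQ⟩ + V.mk ⟨N, d, hd⟩ :=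
    (V.mk_add_of_mul_eq_zero hP hd hPd).symm.trans
      ((V.mk_eq_mk_iff.2 ⟨w, hw, hw'⟩).trans (V.mk_add_of_mul_eq_zero hQ hd hQd))
  refine ⟨z, V.map_inr_injective ?_⟩
  rw [map_add, map_add, hz]
  rwa [hPmk, hQmk] at key

end Comparison

end CStarK

theorem lemmag (B : Type*) [NonUnitalCStarAlgebra B] (hB : CStarK.RealRankZero B) :
    ∃ e : Algebra.GrothendieckAddGroup (CStarK.V B) ≃+ CStarK.K₀ B,
      ∀ x : CStarK.V B,
        (e (Algebra.GrothendieckAddGroup.of x) :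
            Algebra.GrothendieckAddGroup (CStarK.V (Unitization ℂ B))) =
          Algebra.GrothendieckAddGroup.of
            (CStarK.V.map (Unitization.inrNonUnitalStarAlgHom ℂ B) x) := by
  open CStarK Algebra in
  obtain ⟨ι, hι⟩ : ∃ ι, ι = V.map (Unitization.inrNonUnitalStarAlgHom ℂ B) := ⟨_, rfl⟩
  have hmem : ∀ g, grothendieckMap ι g ∈ K₀ B := by
    intro g
    obtain ⟨x, y, rfl⟩ := exists_eq_of_sub_of g
    change grothendieckMap (V.map (unitizationProj B)) _ = 0
    simp only [map_sub, grothendieckMap_of, hι, unitizationProj_comp_inr, map_zero, sub_self]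
  have hinj : Function.Injective (grothendieckMap ι) := by
    rw [injective_iff_map_eq_zero]
    intro g hg
    obtain ⟨x, y, rfl⟩ := exists_eq_of_sub_of g
    rw [map_sub, sub_eq_zero, grothendieckMap_of, grothendieckMap_of, of_eq_of_iff] at hg
    obtain ⟨c, hc⟩ := hg
    rw [sub_eq_zero, of_eq_of_iff]
    exact V.exists_add_eq_add hB (hι ▸ hc)
  have hsurj : ∀ g ∈ K₀ B, ∃ a, grothendieckMap ι a = g := by
    intro g hg
    obtain ⟨X, Y, rfl⟩ := exists_eq_of_sub_of g
    replace hg : grothendieckMap (V.map (unitizationProj B)) _ = 0 := hg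
    -- Pushing `hg` forward along the splitting shows that `X` and `Y` have the same scalar part.
    replace hg := congrArg (grothendieckMap (V.map (unitizationSection B))) hg
    simp only [map_sub, grothendieckMap_of, map_zero, sub_eq_zero] at hg
    obtain ⟨x, y, hX⟩ := V.exists_add_map_section_eq hB X
    obtain ⟨x', y', hY⟩ := V.exists_add_map_section_eq hB Y
    refine ⟨(GrothendieckAddGroup.of x - GrothendieckAddGroup.of y) -
      (GrothendieckAddGroup.of x' - GrothendieckAddGroup.of y'), ?_⟩
    replace hX := congrArg GrothendieckAddGroup.of hX
    replace hY := congrArg GrothendieckAddGroup.of hY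
    simp only [map_add] at hX hY
    simp only [map_sub, grothendieckMap_of, hι]
    rw [eq_sub_of_add_eq hX, eq_sub_of_add_eq hY, hg]
    abel
  refine ⟨AddEquiv.ofBijective ((grothendieckMap ι).codRestrict (K₀ B) hmem) ⟨?_, ?_⟩, ?_⟩
  · exact fun a b h => hinj (congrArg Subtype.val h)
  · rintro ⟨g, hg⟩
    obtain ⟨a, ha⟩ := hsurj g hg
    exact ⟨a, Subtype.ext ha⟩
  · intro x
    exact (grothendieckMap_of ι x).trans (by rw [hι])
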